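/- A $3$-graph is a family $H$ of $3$-element subsets (edges) of a finite vertex set. For a $3$-graph $F$, let $\mathrm{ex}_3(n,F)$ denote the maximum number of edges in a $3$-graph on $n$ vertices that does not contain a (not necessarily induced) copy of $F$. The expansion $G^+$ of a graph $G$ is the $3$-graph with edge set $\{e\cup\{v_e\} : e\in E(G)\}$, where the $v_e$ are distinct new vertices not in $V(G)$. Let $K_{s,t}$ be the complete bipartite graph with parts of sizes $s$ and $t$. Theorem. Fix integers $3\le s\le t$. Then, as $n\to\infty$, $$\mathrm{ex}_3(n,K_{s,t}^+)=O\big(n^{3-\frac{3}{s}}\big),$$ and if moreover $t>(s-1)!$, then $$\mathrm{ex}_3(n,K_{s,t}^+)=\Theta\big(n^{3-\frac{3}{s}}\big).$$ The implied constants may depend on $s$ and $t$. -/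

import Mathlib

open Filter Asymptotics
open scoped Nat

/-- A hypergraph on the vertex set `V` is represented by its edge set, a finite family of finite
subsets of `V`; it is an `r`-graph if it is `Set.Sized r`, i.e. all its edges have `r` elements.
`HypergraphContains F H` says that `H` contains a (not necessarily induced) copy of `F`: there is
an injection of the vertices of `F` into those of `H` taking every edge of `F` to an edge of `H`. -/
def HypergraphContains {W V : Type*} (F : Finset (Finset W)) (H : Finset (Finset V)) : Prop :=
  ∃ f : W ↪ V, ∀ e ∈ F, e.map f ∈ H

open scoped Classical in
/-- The Turán number `ex_r(n, F)`: the maximum number of edges of an `r`-graph on `n` vertices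
that does not contain `F`. -/
noncomputable def turanNumber (r n : ℕ) {W : Type*} (F : Finset (Finset W)) : ℕ :=
  Finset.sup {H : Finset (Finset (Fin n)) | (H : Set (Finset (Fin n))).Sized r ∧
    ¬ HypergraphContains F H} Finset.card

open scoped Classical in
/-- The expansion `G⁺` of a graph `G`: every edge `e` of `G` is enlarged by a new vertex `v_e`,
and distinct edges get distinct new vertices. The vertices are those of `G` (`Sum.inl v`) together
with the new vertices (`v_e = Sum.inr e`). -/
noncomputable def graphExpansion {V : Type*} [Fintype V] (G : SimpleGraph V) :
    Finset (Finset (V ⊕ G.edgeSet)) :=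
  Finset.univ.image fun e : G.edgeSet =>
    insert (Sum.inr e) ((e : Sym2 V).toFinset.map Function.Embedding.inl)

/-- The `3`-graph `K_{s,t}⁺`. -/
noncomputable def completeBipartiteExpansion (s t : ℕ) :
    Finset (Finset ((Fin s ⊕ Fin t) ⊕ (completeBipartiteGraph (Fin s) (Fin t)).edgeSet)) :=
  graphExpansion (completeBipartiteGraph (Fin s) (Fin t))

/-! Upper bound. Deleting few edges from a `K_{s,t}⁺`-free `3`-graph, at a cost `O(n²)`, makes every
pair that is still covered lie in many edges. The graph of covered pairs is then `K_{s,t}`-free,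
since otherwise distinct expansion vertices could be chosen by Hall's theorem, and the surviving
edges are among its triangles. Triangles are counted by Kővári–Sós–Turán twice: in the whole graph,
and inside each neighbourhood, which contains no `K_{s-1,t}`. Power mean and Hölder inequalities
combine the two into `O(n^{3-3/s})`, and `n²` is absorbed because `s ≥ 3`.

Lower bound. The triangles of a `K_{s,t}`-free graph form a `K_{s,t}⁺`-free `3`-graph. With `k = s -
1`, the projective norm graph has at most `q^{k+1}` vertices and no `K_{k+1,k!+1}`. In
characteristic two every field element is a square, so any three first coordinates extend to a
triangle; this gives about `q^{3k}/6` triangles, the order `n^{3-3/s}` for `n ≈ q^s`.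

Excluding `K_{k+1,k!+1}` rests on the Kollár–Rónyai–Szabó bound for the system `∏ j, (x_j - a_{ij})
= b_i`. The products `f_i` make the polynomial ring finite over the integrally closed ring `K[f_1,
…, f_k]`. The fibre over zero is reduced with `k!` points, one per permutation, so `k!` elements
generate locally there. This bounds the degree of the extension, hence the size of every fibre. -/

/-! ### Commutative algebra: fibres of finite extensions -/

/-- For a finite extension of domains with integrally closed base ring, the number of points of a
fibre is at most the number of elements that generate the extension locally at one point. -/
theorem card_fibre_le_of_span_sup_eq_top {S R K ι : Type*} [CommRing S] [IsDomain S]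
    [IsIntegrallyClosed S] [CommRing R] [IsDomain R] [Algebra S R] [Module.IsTorsionFree S R]
    [Module.Finite S R] [Field K] [Fintype ι] {N : ℕ} (m : Ideal S) (hm : m ≠ ⊤) (e : Fin N → R)
    (he : (⊤ : Submodule S R) ≤ Submodule.span S (Set.range e) ⊔ m • ⊤)
    (χ : ι → R →+* K) (ψ : S →+* K) (hχ : ∀ i, (χ i).comp (algebraMap S R) = ψ)
    (h : R) (hinj : Function.Injective fun i => χ i h) : Fintype.card ι ≤ N := by
  classical
  -- Nakayama: some `r ≡ 1` modulo `m` multiplies all of `R` into the span of `e`.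
  obtain ⟨r, hr, hsmul⟩ := Submodule.exists_sub_one_mem_and_smul_le_of_fg_of_le_sup
    (Module.Finite.fg_top (R := S) (M := R)) le_rfl he
  have hr0 : r ≠ 0 := by
    rintro rfl
    exact hm ((Ideal.eq_top_iff_one m).2 (by simpa using hr))
  have hmem : ∀ x : R, r • x ∈ Submodule.span S (Set.range e) := fun x =>
    hsmul (Submodule.smul_mem_pointwise_smul x r ⊤ trivial)
  have hint : IsIntegral S h := Algebra.IsIntegral.isIntegral h
  -- Multiplied by `r`, the `N + 1` powers of `h` lie in a module with `N` generators.
  have hdep : ¬ LinearIndependent S (fun j : Fin (N + 1) => h ^ (j : ℕ)) := by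
    intro hli
    have hli' : LinearIndependent S (fun j : Fin (N + 1) => r • h ^ (j : ℕ)) := by
      rw [Fintype.linearIndependent_iff] at hli ⊢
      intro g hg
      have := hli g (by
        have h2 : r • ∑ j, g j • h ^ (j : ℕ) = 0 := by
          rw [Finset.smul_sum, ← hg]
          exact Finset.sum_congr rfl fun j _ => smul_comm _ _ _
        exact (smul_eq_zero.1 h2).resolve_left hr0)
      exact this
    have hli'' : LinearIndependent S (fun j : Fin (N + 1) =>
        (⟨r • h ^ (j : ℕ), hmem _⟩ : Submodule.span S (Set.range e))) :=
      LinearIndependent.of_comp (Submodule.span S (Set.range e)).subtype (by exact hli')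
    have := linearIndependent_le_span' _ hli''
      (Set.range fun i => (⟨e i, Submodule.subset_span ⟨i, rfl⟩⟩ :
        Submodule.span S (Set.range e))) (by
          rw [Set.range_subset_iff]
          intro j
          have h3 : (Submodule.span S (Set.range fun i =>
            (⟨e i, Submodule.subset_span ⟨i, rfl⟩⟩ : Submodule.span S (Set.range e)))) = ⊤ := by
            have := Submodule.span_span_coe_preimage (R := S) (s := Set.range e)
            convert this using 2
            ext ⟨x, hx⟩
            simp
          rw [h3]; trivial)
    have h4 : Fintype.card (Set.range fun i => (⟨e i, Submodule.subset_span ⟨i, rfl⟩⟩ :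
        Submodule.span S (Set.range e))) ≤ N :=
      (Fintype.card_range_le _).trans_eq (Fintype.card_fin N)
    rw [Cardinal.mk_fin, Nat.cast_le] at this
    omega
  rw [Fintype.linearIndependent_iff] at hdep
  push Not at hdep
  obtain ⟨g, hg, j, hj⟩ := hdep
  set p : Polynomial S := ∑ j : Fin (N + 1), Polynomial.monomial (j : ℕ) (g j) with hp
  have hp0 : p ≠ 0 := by
    intro hzero
    apply hj
    have := congrArg (fun q => Polynomial.coeff q (j : ℕ)) hzero
    simpa [hp, Polynomial.finsetSum_coeff, Polynomial.coeff_monomial, Fin.val_inj] using this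
  have hpa : Polynomial.aeval h p = 0 := by
    rw [hp, map_sum, ← hg]
    exact Finset.sum_congr rfl fun j _ => by rw [Polynomial.aeval_monomial, Algebra.smul_def]
  have hpd : p.degree < ((N + 1 : ℕ) : WithBot ℕ) := by
    rw [hp]
    refine (Polynomial.degree_sum_le _ _).trans_lt ((Finset.sup_lt_iff (by
      exact WithBot.bot_lt_coe (N + 1))).2 fun j _ => ?_)
    exact (Polynomial.degree_monomial_le _ _).trans_lt (by exact_mod_cast j.2)
  -- Over an integrally closed base the monic minimal polynomial has least degree among all nonzero
  -- annihilators, so the possibly non-monic `p` bounds it.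
  have hdeg : (minpoly S h).natDegree ≤ N := by
    have h1 := (minpoly.IsIntegrallyClosed.degree_le_of_ne_zero hp0 hpa).trans_lt hpd
    rw [Polynomial.degree_eq_natDegree (minpoly.ne_zero hint)] at h1
    exact Nat.lt_succ_iff.1 (by exact_mod_cast h1)
  set P := (minpoly S h).map ψ with hP
  have hP0 : P ≠ 0 := ((minpoly.monic hint).map ψ).ne_zero
  have hroot : ∀ i, χ i h ∈ P.roots.toFinset := by
    intro i
    rw [Multiset.mem_toFinset, Polynomial.mem_roots hP0, Polynomial.IsRoot, hP,
      Polynomial.eval_map, ← hχ i, ← Polynomial.hom_eval₂]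
    have := minpoly.aeval S h
    rw [Polynomial.aeval_def] at this
    rw [this, map_zero]
  calc Fintype.card ι = (Finset.univ.image fun i => χ i h).card := by
        rw [Finset.card_image_of_injective _ hinj, Finset.card_univ]
    _ ≤ P.roots.toFinset.card := Finset.card_le_card (by
        intro y hy
        obtain ⟨i, -, rfl⟩ := Finset.mem_image.1 hy
        exact hroot i)
    _ ≤ N := (Multiset.toFinset_card_le _).trans ((Polynomial.card_roots' _).trans
        ((Polynomial.natDegree_map_le).trans hdeg))

namespace MvPolynomial

variable {σ K : Type*} [Field K]

/-- A polynomial is congruent to its value at `p` modulo an ideal that contains all `X j - p j`. -/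
theorem sub_C_eval_mem {J : Ideal (MvPolynomial σ K)} {p : σ → K}
    (hJ : ∀ j, X j - C (p j) ∈ J) (g : MvPolynomial σ K) : g - C (eval p g) ∈ J := by
  rw [← Ideal.Quotient.eq]
  have : Ideal.Quotient.mk J = ((Ideal.Quotient.mk J).comp C).comp (eval p) := by
    refine ringHom_ext (fun c => by simp) fun j => ?_
    simpa using Ideal.Quotient.eq.2 (hJ j)
  exact DFunLike.congr_fun this g

/-- Interpolation: finitely many distinct points are separated by polynomials. -/
theorem exists_eval_eq_ite {ι : Type*} [Fintype ι] [DecidableEq ι] (p : ι → σ → K)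
    (hp : Function.Injective p) :
    ∃ e : ι → MvPolynomial σ K, ∀ i j, eval (p j) (e i) = if i = j then 1 else 0 := by
  have hsep : ∀ i j, ∃ q : MvPolynomial σ K, i ≠ j → eval (p i) q = 1 ∧ eval (p j) q = 0 := by
    intro i j
    by_cases hij : i = j
    · exact ⟨0, fun h => absurd hij h⟩
    obtain ⟨l, hl⟩ := Function.ne_iff.1 (hp.ne hij)
    refine ⟨C (p i l - p j l)⁻¹ * (X l - C (p j l)), fun _ => ⟨?_, by simp⟩⟩
    simp [inv_mul_cancel₀ (sub_ne_zero.2 hl)]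
  choose q hq using hsep
  refine ⟨fun i => ∏ j ∈ Finset.univ.erase i, q i j, fun i j => ?_⟩
  rw [map_prod]
  split_ifs with hij
  · subst hij
    exact Finset.prod_eq_one fun l hl => (hq i l (Finset.ne_of_mem_erase hl).symm).1
  · exact Finset.prod_eq_zero (Finset.mem_erase.2 ⟨Ne.symm hij, Finset.mem_univ j⟩) (hq i j hij).2

end MvPolynomial

/-! ### The Kollár–Rónyai–Szabó theorem -/

namespace MvPolynomial

variable {K : Type*} [Field K] {k : ℕ} (a : Fin k → Fin k → K)

/-- The polynomial `∏ j, (x_j - a_{ij})`. -/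
noncomputable def rowProduct (i : Fin k) : MvPolynomial (Fin k) K :=
  ∏ j, (X j - C (a i j))

theorem X_sub_C_ne_zero (j : Fin k) (c : K) : (X j - C c : MvPolynomial (Fin k) K) ≠ 0 := by
  intro h
  have := congrArg (eval fun _ => c + 1) h
  simp at this

theorem eval_rowProduct (x : Fin k → K) (i : Fin k) :
    eval x (rowProduct a i) = ∏ j, (x j - a i j) := by
  simp [rowProduct, map_prod]

/-- If a proper ideal contains a linear form `x_j - a_{ij}` for every row `i`, then these forms
use every column exactly once. -/
theorem exists_perm_of_forall_exists_mem (ha : ∀ j, Function.Injective fun i => a i j)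
    {M : Ideal (MvPolynomial (Fin k) K)} (hM : M ≠ ⊤) (h : ∀ i, ∃ j, X j - C (a i j) ∈ M) :
    ∃ π : Equiv.Perm (Fin k), ∀ j, X j - C (a (π j) j) ∈ M := by
  choose c hc using h
  have hinj : Function.Injective c := by
    intro i i' hii
    by_contra hne
    have h1 := M.sub_mem (hc i) (hii ▸ hc i')
    have h2 : a i' (c i) - a i (c i) ≠ 0 := sub_ne_zero.2 fun h => hne (ha _ h).symm
    rw [sub_sub_sub_cancel_left, ← C_sub] at h1
    exact hM (Ideal.eq_top_of_isUnit_mem _ h1 ((isUnit_iff_ne_zero.2 h2).map C))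
  let π := Equiv.ofBijective c (Finite.injective_iff_bijective.1 hinj)
  refine ⟨π.symm, fun j => ?_⟩
  have h3 := hc (π.symm j)
  rwa [show c (π.symm j) = j from π.apply_symm_apply j] at h3

/-- This says that the fibre over zero is reduced. Locally at one of its points all factors off the
corresponding permutation are units, so the row products generate the maximal ideal of the point. -/
theorem mem_span_rowProduct (ha : ∀ j, Function.Injective fun i => a i j)
    (g : MvPolynomial (Fin k) K)
    (hg : ∀ π : Equiv.Perm (Fin k), eval (fun j => a (π j) j) g = 0) :
    g ∈ Ideal.span (Set.range (rowProduct a)) := by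
  set I := Ideal.span (Set.range (rowProduct a)) with hI
  have hfI : ∀ i, rowProduct a i ∈ I := fun i => Ideal.subset_span ⟨i, rfl⟩
  -- `J u` is the colon ideal `(I : u)`. If `g` is not in `I`, then `J g` lies in a maximal ideal.
  let J : MvPolynomial (Fin k) K → Ideal (MvPolynomial (Fin k) K) := fun u =>
    Submodule.comap (LinearMap.mulLeft (MvPolynomial (Fin k) K) u) I
  have hJ : ∀ u r, r ∈ J u ↔ u * r ∈ I := fun u r => Iff.rfl
  suffices h : J g = ⊤ by
    have : (1 : MvPolynomial (Fin k) K) ∈ J g := by rw [h]; trivial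
    simpa [hJ] using this
  by_contra hne
  obtain ⟨M, hM, hle⟩ := Ideal.exists_le_maximal _ hne
  have hMp := hM.isPrime
  have hIM : I ≤ M := fun r hr => hle ((hJ g r).2 (I.mul_mem_left _ hr))
  obtain ⟨π, hπ⟩ := exists_perm_of_forall_exists_mem a ha hM.ne_top (fun i => by
    have := hIM (hfI i)
    rw [rowProduct, hMp.prod_mem_iff] at this
    simpa using this)
  have hnot : ∀ i j, i ≠ π j → X j - C (a i j) ∉ M := by
    intro i j hij hmem
    have h1 := M.sub_mem (hπ j) hmem
    have h2 : a i j - a (π j) j ≠ 0 := sub_ne_zero.2 fun h => hij (ha _ h)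
    rw [sub_sub_sub_cancel_left, ← C_sub] at h1
    exact hM.ne_top (Ideal.eq_top_of_isUnit_mem _ h1 ((isUnit_iff_ne_zero.2 h2).map C))
  -- The product of all factors off the permutation: it avoids `M` and multiplies each `X l - C (a
  -- (π l) l)` into `I`.
  let u : MvPolynomial (Fin k) K :=
    ∏ l, ∏ j ∈ Finset.univ.erase l, (X j - C (a (π l) j))
  have hu : u ∉ M := by
    rw [hMp.prod_mem_iff]
    rintro ⟨l, -, hl⟩
    rw [hMp.prod_mem_iff] at hl
    obtain ⟨j, hj, hl⟩ := hl
    exact hnot _ _ (fun h => Finset.ne_of_mem_erase hj (π.injective h).symm) hl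
  have hX : ∀ l, X l - C (a (π l) l) ∈ J u := by
    intro l
    rw [hJ]
    have h1 : rowProduct a (π l) ∣ u * (X l - C (a (π l) l)) := by
      rw [rowProduct, ← Finset.mul_prod_erase _ _ (Finset.mem_univ l), mul_comm]
      exact mul_dvd_mul (Finset.dvd_prod_of_mem
        (fun l => ∏ j ∈ Finset.univ.erase l, (X j - C (a (π l) j))) (Finset.mem_univ l)) dvd_rfl
    exact I.mem_of_dvd h1 (hfI _)
  have h2 := sub_C_eval_mem (p := fun l => a (π l) l) hX g
  rw [hg π, C_0, sub_zero, hJ, mul_comm] at h2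
  exact hu (hle ((hJ g u).2 h2))

/-- The integral closure of a subring in a field is the intersection of the valuation rings
containing it, so it suffices to put each variable into every valuation ring that contains the row
products and constants. -/
theorem isIntegral_adjoin_rowProduct (ha : ∀ j, Function.Injective fun i => a i j) :
    Algebra.IsIntegral (Algebra.adjoin K (Set.range (rowProduct a)))
      (MvPolynomial (Fin k) K) := by
  set A := Algebra.adjoin K (Set.range (rowProduct a)) with hA
  let R := MvPolynomial (Fin k) K
  let F := FractionRing R
  have hfA : ∀ i, rowProduct a i ∈ A := fun i => Algebra.subset_adjoin ⟨i, rfl⟩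
  let θ : A →+* F := (algebraMap R F).comp (algebraMap A R)
  have hθ : Function.Injective θ :=
    (IsFractionRing.injective R F).comp Subtype.val_injective
  have hX : ∀ j, algebraMap R F (X j) ∈
      (⨅ V : {V : ValuationSubring F // (θ.range : Set F) ⊆ V.toSubring}, V.1.toSubring) := by
    intro j₀
    rw [Subring.mem_iInf]
    rintro ⟨V, hV⟩
    change algebraMap R F (X j₀) ∈ V
    have hAV : ∀ r ∈ A, algebraMap R F r ∈ V := fun r hr => hV ⟨⟨r, hr⟩, rfl⟩
    have hCV : ∀ c, algebraMap R F (C c) ∈ V := fun c => hAV _ (A.algebraMap_mem c)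
    set y : Fin k → Fin k → F := fun i j => algebraMap R F (X j - C (a i j)) with hy
    have hy0 : ∀ i j, y i j ≠ 0 := fun i j => by
      rw [hy]
      simpa using (IsFractionRing.injective R F).ne_iff' (map_zero _) |>.2 (X_sub_C_ne_zero j (a i j))
    have hXy : ∀ i j, algebraMap R F (X j) = y i j + algebraMap R F (C (a i j)) := by
      intro i j; simp [hy]
    -- If a row has all inverses in `V`, dividing its product by the other factors gives the factor
    -- in column `j₀`. Otherwise each row has a factor of valuation below one. Two such factors
    -- never share a column, as their difference would be a nonzero constant, so column `j₀` is hit.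
    by_cases h : ∃ i, ∀ j, (y i j)⁻¹ ∈ V
    · obtain ⟨i, hi⟩ := h
      have h1 : y i j₀ = algebraMap R F (rowProduct a i) *
          ∏ j ∈ Finset.univ.erase j₀, (y i j)⁻¹ := by
        rw [rowProduct, map_prod, ← Finset.mul_prod_erase _ _ (Finset.mem_univ j₀), mul_assoc,
          ← Finset.prod_mul_distrib, Finset.prod_eq_one, mul_one]
        exact fun j _ => mul_inv_cancel₀ (hy0 i j)
      rw [hXy i, h1]
      exact V.add_mem _ _ (V.mul_mem _ _ (hAV _ (hfA i)) (prod_mem fun j _ => hi j)) (hCV _)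
    · push Not at h
      choose c hc using h
      have hcV : ∀ i, y i (c i) ∈ V := fun i => (V.mem_or_inv_mem _).resolve_right (hc i)
      have hlt : ∀ i, V.valuation (y i (c i)) < 1 := fun i => by
        by_contra hge
        apply hc i
        rw [← V.valuation_le_one_iff, map_inv₀]
        exact inv_le_one_of_one_le₀ (not_lt.1 hge)
      have hinj : Function.Injective c := by
        intro i i' hii
        by_contra hne
        have h1 := V.valuation.map_sub_lt (hlt i) (hii ▸ hlt i')
        have h2 : a i' (c i) - a i (c i) ≠ 0 := sub_ne_zero.2 fun h => hne (ha _ h).symm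
        have h3 : y i (c i) - y i' (c i) = algebraMap R F (C (a i' (c i) - a i (c i))) := by
          simp [hy]
        rw [h3] at h1
        have h4 := (V.valuation_le_one_iff _).2 (hCV (a i' (c i) - a i (c i))⁻¹)
        have h5 : algebraMap R F (C (a i' (c i) - a i (c i))) *
            algebraMap R F (C (a i' (c i) - a i (c i))⁻¹) = 1 := by
          rw [← map_mul, ← C_mul, mul_inv_cancel₀ h2, C_1, map_one]
        have h6 := congrArg V.valuation h5
        rw [map_mul, map_one] at h6
        exact absurd h6 (mul_lt_one_of_lt_of_le h1 h4).ne
      obtain ⟨i, rfl⟩ := Finite.surjective_of_injective hinj j₀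
      rw [hXy i]
      exact V.add_mem _ _ (hcV i) (hCV _)
  have hXint : ∀ j, IsIntegral A (X j : R) := by
    intro j
    have h1 := hX j
    rw [iInf_valuationSubring_superset, Subring.closure_eq] at h1
    have h2 : IsIntegral θ.range (algebraMap R F (X j)) := h1
    let eq : A ≃+* θ.range := RingEquiv.ofBijective θ.rangeRestrict
      ⟨fun x y hxy => hθ (congrArg Subtype.val hxy), θ.rangeRestrict_surjective⟩
    have h3 : IsIntegral A (RingHom.id F (algebraMap R F (X j))) := by
      refine h2.map_of_comp_eq eq.symm.toRingHom (RingHom.id F) ?_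
      ext x
      obtain ⟨x, rfl⟩ := eq.surjective x
      simp
      rfl
    exact (isIntegral_algebraMap_iff (IsFractionRing.injective R F)).1 h3
  refine ⟨fun r => ?_⟩
  induction r using MvPolynomial.induction_on with
  | C c => exact isIntegral_algebraMap (x := algebraMap K A c)
  | add p q hp hq => exact hp.add hq
  | mul_X p j hp => exact hp.mul (hXint j)

/-- A ring of transcendence degree `k` is algebraic over these `k` elements, which leaves no room
for a relation. -/
theorem algebraicIndependent_rowProduct (ha : ∀ j, Function.Injective fun i => a i j) :
    AlgebraicIndependent K (rowProduct a) := by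
  have := isIntegral_adjoin_rowProduct a ha
  refine (Algebra.IsAlgebraic.isTranscendenceBasis_of_lift_le_trdeg_of_finite K
    (rowProduct a) ?_).1
  simp [MvPolynomial.trdeg_of_isDomain]

/-- **Kollár–Rónyai–Szabó.** If every column of the matrix `a` has distinct entries, the system
`∏ j, (x_j - a_{ij}) = b_i` has at most `k!` solutions. -/
theorem card_solutions_prod_sub_le_factorial [Infinite K]
    (ha : ∀ j, Function.Injective fun i => a i j) (b : Fin k → K) {ι : Type*} [Fintype ι]
    (z : ι → Fin k → K) (hz : Function.Injective z)
    (hzb : ∀ l i, ∏ j, (z l j - a i j) = b i) : Fintype.card ι ≤ k ! := by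
  classical
  set A := Algebra.adjoin K (Set.range (rowProduct a)) with hA
  let R := MvPolynomial (Fin k) K
  have hint : Algebra.IsIntegral A R := isIntegral_adjoin_rowProduct a ha
  have hfA : ∀ i, rowProduct a i ∈ A := fun i => Algebra.subset_adjoin ⟨i, rfl⟩
  have hclosed : IsIntegrallyClosed A :=
    IsIntegrallyClosed.of_equiv (algebraicIndependent_rowProduct a ha).aevalEquiv.toRingEquiv
  have hft : Algebra.FiniteType A R := Algebra.FiniteType.of_restrictScalars_finiteType K A R
  have hfin : Module.Finite A R := Algebra.IsIntegral.finite
  let p : Equiv.Perm (Fin k) → Fin k → K := fun π j => a (π j) j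
  have hp : Function.Injective p := fun π τ h =>
    Equiv.ext fun j => ha j (congrFun h j)
  obtain ⟨e, he⟩ := exists_eval_eq_ite p hp
  have hcard : Fintype.card (Equiv.Perm (Fin k)) = k ! := by
    rw [Fintype.card_perm, Fintype.card_fin]
  let eqv := Fintype.equivFinOfCardEq hcard
  let m : Ideal A := Ideal.span (Set.range fun i => (⟨rowProduct a i, hfA i⟩ : A))
  have hm : m ≠ ⊤ := by
    intro htop
    have hle : m ≤ RingHom.ker ((eval (p 1)).comp (algebraMap A R)) := by
      rw [Ideal.span_le]
      rintro _ ⟨i, rfl⟩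
      change eval (p 1) (rowProduct a i) = 0
      rw [eval_rowProduct]
      exact Finset.prod_eq_zero (Finset.mem_univ i) (by simp [p])
    have h1 : (1 : A) ∈ RingHom.ker ((eval (p 1)).comp (algebraMap A R)) :=
      hle (by rw [htop]; trivial)
    rw [RingHom.mem_ker, map_one] at h1
    exact one_ne_zero h1
  have hspan : (⊤ : Submodule A R) ≤
      Submodule.span A (Set.range (e ∘ eqv.symm)) ⊔ m • ⊤ := by
    intro g _
    set g' : R := ∑ π, C (eval (p π) g) * e π with hg'
    have h1 : g' ∈ Submodule.span A (Set.range (e ∘ eqv.symm)) := by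
      refine Submodule.sum_mem _ fun π _ => ?_
      have : C (eval (p π) g) * e π = (algebraMap K A (eval (p π) g)) • e π := by
        rw [Algebra.smul_def]; rfl
      rw [this]
      exact Submodule.smul_mem _ _ (Submodule.subset_span ⟨eqv π, by simp⟩)
    have h2 : g - g' ∈ Ideal.span (Set.range (rowProduct a)) := by
      refine mem_span_rowProduct a ha _ fun π => ?_
      change eval (p π) (g - g') = 0
      simp [hg', he]
    have h3 : g - g' ∈ m • (⊤ : Submodule A R) := by
      have hle : Ideal.span (Set.range (rowProduct a)) ≤ m.map (algebraMap A R) := by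
        rw [Ideal.span_le]
        rintro _ ⟨i, rfl⟩
        exact Ideal.mem_map_of_mem (algebraMap A R)
          (Ideal.subset_span ⟨i, rfl⟩ : (⟨rowProduct a i, hfA i⟩ : A) ∈ m)
      rw [Ideal.smul_top_eq_map]
      exact hle h2
    rw [← add_sub_cancel g' g]
    exact Submodule.add_mem_sup h1 h3
  -- Over an infinite field some linear form separates finitely many points.
  obtain ⟨w, hw⟩ := Module.exists_dual_forall_apply_ne_zero (K := K)
    (fun q : {q : ι × ι // q.1 ≠ q.2} => z q.1.1 - z q.1.2)
    (fun q => sub_ne_zero.2 (hz.ne q.2))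
  let h : R := ∑ j, C (w (Pi.single j 1)) * X j
  have hh : ∀ x : Fin k → K, eval x h = w x := by
    intro x
    conv_rhs => rw [pi_eq_sum_univ' x]
    simp [h, mul_comm]
  rcases isEmpty_or_nonempty ι with hι | ⟨⟨l₀⟩⟩
  · simp
  refine card_fibre_le_of_span_sup_eq_top (S := A) (R := R) (K := K) m hm (e ∘ eqv.symm) hspan
    (fun l => eval (z l)) ((eval (z l₀)).comp (algebraMap A R)) (fun l => ?_) h ?_
  · ext ⟨x, hx⟩
    change eval (z l) x = eval (z l₀) x
    induction hx using Algebra.adjoin_induction with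
    | mem x hx =>
      obtain ⟨i, rfl⟩ := hx
      rw [eval_rowProduct, eval_rowProduct, hzb, hzb]
    | algebraMap c => exact (eval_C c).trans (eval_C c).symm
    | add x y _ _ hx hy => rw [map_add, map_add, hx, hy]
    | mul x y _ _ hx hy => rw [map_mul, map_mul, hx, hy]
  · intro l l' hll
    by_contra hne
    apply hw ⟨(l, l'), hne⟩
    have : eval (z l) h = eval (z l') h := hll
    rw [hh, hh] at this
    simp [this]

end MvPolynomial

/-! ### Projective norm graphs in characteristic two -/

section NormGraph

variable {L : Type*} [Field L]

/-- The norm `x^{1 + q + ⋯ + q^{k-1}}` from the field with `q^k` elements to that with `q`. -/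
def powNorm (q k : ℕ) (x : L) : L := ∏ j : Fin k, x ^ q ^ (j : ℕ)

theorem powNorm_mul (q k : ℕ) (x y : L) : powNorm q k (x * y) = powNorm q k x * powNorm q k y := by
  simp [powNorm, mul_pow, Finset.prod_mul_distrib]

theorem powNorm_inv (q k : ℕ) (x : L) : powNorm q k x⁻¹ = (powNorm q k x)⁻¹ := by
  simp [powNorm]

theorem powNorm_ne_zero {q k : ℕ} {x : L} (hx : x ≠ 0) : powNorm q k x ≠ 0 :=
  Finset.prod_ne_zero_iff.2 fun _ _ => pow_ne_zero _ hx

theorem powNorm_zero {q k : ℕ} (hq : q ≠ 0) (hk : 0 < k) : powNorm q k (0 : L) = 0 :=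
  Finset.prod_eq_zero (Finset.mem_univ ⟨0, hk⟩) (zero_pow (pow_ne_zero _ hq))

/-- Raising to the power `q` permutes the factors cyclically, so the norm lands in the subfield with
`q` elements. -/
theorem powNorm_pow {q k : ℕ} {x : L} (hx : x ^ q ^ k = x) :
    powNorm q k x ^ q = powNorm q k x := by
  cases k with
  | zero => simp [powNorm]
  | succ k =>
    rw [powNorm, ← Finset.prod_pow, Fin.prod_univ_castSucc, Fin.prod_univ_succ, mul_comm]
    simp only [Fin.val_last, Fin.val_castSucc, Fin.val_succ, ← pow_mul, ← pow_succ, Fin.val_zero,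
      pow_zero, pow_one, hx]

variable (L) in
/-- The vertices of the projective norm graph: the second coordinate is a nonzero element of the
subfield with `q` elements. -/
abbrev NormGraphVertex (q : ℕ) : Type _ := {p : L × L // p.2 ≠ 0 ∧ p.2 ^ q = p.2}

variable (L) in
/-- The projective norm graph: `(A, a)` and `(B, b)` are adjacent if `N (A + B) = a b`. -/
def projectiveNormGraph (q k : ℕ) : SimpleGraph (NormGraphVertex L q) where
  Adj p r := p ≠ r ∧ powNorm q k (p.1.1 + r.1.1) = p.1.2 * r.1.2
  symm := ⟨fun p r h => ⟨h.1.symm, by rw [add_comm, h.2, mul_comm]⟩⟩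
  loopless := ⟨fun _ h => h.1 rfl⟩

/-- The projective norm graph in characteristic two contains no `K_{k+1,k!+1}`. -/
theorem le_factorial_of_forall_projectiveNormGraph_adj [CharP L 2] {q m k t : ℕ}
    (hq : q = 2 ^ m) (hk : 0 < k)
    (τ : Fin (k + 1) ↪ NormGraphVertex L q) (ψ : Fin t ↪ NormGraphVertex L q)
    (h : ∀ i j, (projectiveNormGraph L q k).Adj (τ i) (ψ j)) : t ≤ k ! := by
  have hq0 : q ≠ 0 := by rw [hq]; positivity
  rcases Nat.eq_zero_or_pos t with rfl | ht
  · exact Nat.zero_le _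
  let A : Fin (k + 1) → L := fun i => (τ i).1.1
  let α : Fin (k + 1) → L := fun i => (τ i).1.2
  let X : Fin t → L := fun j => (ψ j).1.1
  let x : Fin t → L := fun j => (ψ j).1.2
  have hα : ∀ i, α i ≠ 0 := fun i => (τ i).2.1
  have hx : ∀ j, x j ≠ 0 := fun j => (ψ j).2.1
  have hN : ∀ i j, powNorm q k (A i + X j) = α i * x j := fun i j => (h i j).2
  have hA : Function.Injective A := by
    intro i i' hii
    apply τ.injective
    refine Subtype.ext (Prod.ext hii ?_)
    have h1 := hN i ⟨0, ht⟩
    rw [hii, hN i'] at h1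
    exact (mul_right_cancel₀ (hx _) h1).symm
  let l := Fin.last k
  let B : Fin k → L := fun i => A i.castSucc + A l
  have hB0 : ∀ i, B i ≠ 0 := by
    intro i h0
    have := hA (CharTwo.add_eq_zero.1 h0)
    exact (Fin.castSucc_lt_last i).ne this
  have hBinj : Function.Injective B := by
    intro i i' hii
    exact Fin.castSucc_injective _ (hA (add_right_cancel hii))
  let W : Fin t → L := fun j => A l + X j
  have hW0 : ∀ j, W j ≠ 0 := by
    intro j h0
    have h1 := hN l j
    rw [show A l + X j = 0 from h0, powNorm_zero hq0 hk] at h1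
    exact mul_ne_zero (hα l) (hx j) h1.symm
  have hWinj : Function.Injective W := by
    intro j j' hjj
    have hX : X j = X j' := add_left_cancel hjj
    apply ψ.injective
    refine Subtype.ext (Prod.ext hX ?_)
    have h1 := hN l j
    rw [hX, hN l j'] at h1
    exact (mul_left_cancel₀ (hα l) h1).symm
  -- Dividing the equation of `A i` by that of the last vertex eliminates `x j`; dividing also by
  -- the norm of `B i` leaves a right side independent of `j`.
  have hsum : ∀ i j, powNorm q k ((W j)⁻¹ + (B i)⁻¹) =
      α i.castSucc * (α l)⁻¹ * (powNorm q k (B i))⁻¹ := by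
    intro i j
    have h1 : (W j)⁻¹ + (B i)⁻¹ = (A i.castSucc + X j) * (W j)⁻¹ * (B i)⁻¹ := by
      have h2 : A i.castSucc + X j = W j + B i := by
        simp only [W, B]
        rw [add_comm (A i.castSucc) (A l), add_add_add_comm, CharTwo.add_self_eq_zero, zero_add,
          add_comm]
      rw [h2]
      field_simp [hW0 j, hB0 i]
      ring
    rw [h1, powNorm_mul, powNorm_mul, powNorm_inv, powNorm_inv, hN, show W j = A l + X j from rfl,
      hN]
    field_simp [hα l, hx j]
  -- The conjugates `(W j)⁻¹ ^ q ^ i` serve as `k` separate unknowns, and additivity of Frobenius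
  -- turns the norm equations into the product system. The closure supplies an infinite field.
  let ι := algebraMap L (AlgebraicClosure L)
  have hcard := MvPolynomial.card_solutions_prod_sub_le_factorial
    (fun i j : Fin k => ι ((B i)⁻¹ ^ q ^ (j : ℕ)))
    (fun j i i' hii => hBinj (inv_injective (by
      have h1 := ι.injective hii
      rw [hq, ← pow_mul] at h1
      exact iterateFrobenius_inj L 2 (m * j) h1)))
    (fun i => ι (α i.castSucc * (α l)⁻¹ * (powNorm q k (B i))⁻¹))
    (fun (j : Fin t) (i : Fin k) => ι ((W j)⁻¹ ^ q ^ (i : ℕ)))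
    (fun j j' hjj => hWinj (inv_injective (by
      have h1 := ι.injective (congrFun hjj ⟨0, hk⟩)
      simpa using h1)))
    (fun j i => by
      rw [← hsum i j, powNorm, map_prod]
      refine Finset.prod_congr rfl fun c _ => ?_
      rw [← map_sub, hq, ← pow_mul, ← sub_pow_char_pow, CharTwo.sub_eq_add])
  simpa using hcard

/-- Any three distinct first coordinates extend to a triangle of the projective norm graph. -/
theorem choose_three_le_card_cliqueFinset [Fintype L] [DecidableEq L] [CharP L 2] {q m k : ℕ}
    (hm : m ≠ 0) (hq : q = 2 ^ m) (hL : Fintype.card L = q ^ k)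
    [Fintype (NormGraphVertex L q)] [DecidableEq (NormGraphVertex L q)]
    [DecidableRel (projectiveNormGraph L q k).Adj] :
    (Fintype.card L).choose 3 ≤ ((projectiveNormGraph L q k).cliqueFinset 3).card := by
  have hx : ∀ x : L, x ^ q ^ k = x := fun x => by rw [← hL, FiniteField.pow_card]
  rw [← Finset.card_univ, ← Finset.card_powersetCard]
  refine Finset.card_le_card_of_surjOn (fun T => T.image fun p => p.1.1) ?_
  intro T hT
  obtain ⟨A, B, C, hAB, hAC, hBC, rfl⟩ := Finset.card_eq_three.1 (Finset.mem_powersetCard.1 hT).2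
  have hsum : ∀ {x y : L}, x ≠ y → x + y ≠ 0 := fun h h0 => h (CharTwo.add_eq_zero.1 h0)
  let N := fun x y : L => powNorm q k (x + y)
  have hN0 : ∀ {x y : L}, x ≠ y → N x y ≠ 0 := fun h => powNorm_ne_zero (hsum h)
  have hNq : ∀ x y : L, N x y ^ q = N x y := fun x y => powNorm_pow (hx _)
  -- The triangle equations force the square of the coordinate at `x` to be `N x y * N x z / N y z`.
  -- As `q = 2 ^ m`, the power `2 ^ (m - 1)` is the square root on the subfield.
  let v := fun x y z : L => (N x y * N x z * (N y z)⁻¹) ^ 2 ^ (m - 1)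
  have hv2 : ∀ x y z, v x y z ^ 2 = N x y * N x z * (N y z)⁻¹ := by
    intro x y z
    simp only [v]
    rw [← pow_mul, ← pow_succ, Nat.sub_add_cancel (Nat.one_le_iff_ne_zero.2 hm), ← hq, mul_pow,
      mul_pow, inv_pow, hNq, hNq, hNq]
  have hcomm : ∀ x y, N x y = N y x := fun x y => by simp only [N, add_comm]
  have hvmem : ∀ {x y z : L}, x ≠ y → x ≠ z → y ≠ z → v x y z ≠ 0 ∧ v x y z ^ q = v x y z := by
    intro x y z hxy hxz hyz
    refine ⟨pow_ne_zero _ (mul_ne_zero (mul_ne_zero (hN0 hxy) (hN0 hxz)) (inv_ne_zero (hN0 hyz))),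
      ?_⟩
    simp only [v]
    rw [pow_right_comm]
    congr 1
    rw [mul_pow, mul_pow, inv_pow, hNq, hNq, hNq]
  have hvv : ∀ {x y z : L}, x ≠ y → x ≠ z → y ≠ z → N x y = v x y z * v y x z := by
    intro x y z hxy hxz hyz
    refine frobenius_inj L 2 ?_
    rw [frobenius_def, frobenius_def, mul_pow, hv2, hv2, hcomm y x]
    field_simp [hN0 hxz, hN0 hyz]
  have hv' : ∀ x y z, v x y z = v x z y := fun x y z => by
    simp only [v]; rw [mul_comm (N x y), hcomm y z]
  refine ⟨{⟨(A, v A B C), hvmem hAB hAC hBC⟩, ⟨(B, v B A C), hvmem hAB.symm hBC hAC⟩,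
    ⟨(C, v C A B), hvmem hAC.symm hBC.symm hAB⟩}, ?_, by simp⟩
  rw [Finset.mem_coe, SimpleGraph.mem_cliqueFinset_iff, SimpleGraph.is3Clique_triple_iff]
  refine ⟨⟨fun h => hAB (congrArg (fun p => p.1.1) h), hvv hAB hAC hBC⟩,
    ⟨fun h => hAC (congrArg (fun p => p.1.1) h), ?_⟩,
    ⟨fun h => hBC (congrArg (fun p => p.1.1) h), ?_⟩⟩
  · change N A C = v A B C * v C A B
    rw [hv' A B C]
    exact hvv hAC hAB hBC.symm
  · change N B C = v B A C * v C A B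
    rw [hv' B A C, hv' C A B]
    exact hvv hBC hAB.symm hAC.symm

theorem card_normGraphVertex_le [Fintype L] {q : ℕ} (hq : 1 < q)
    [Fintype (NormGraphVertex L q)] :
    Fintype.card (NormGraphVertex L q) ≤ Fintype.card L * q := by
  classical
  have hP : (Polynomial.X ^ q - Polynomial.X : Polynomial L) ≠ 0 :=
    FiniteField.X_pow_card_sub_X_ne_zero L hq
  rw [Fintype.card_subtype]
  calc _ ≤ ((Finset.univ : Finset L) ×ˢ
        (Polynomial.X ^ q - Polynomial.X : Polynomial L).roots.toFinset).card := by
        refine Finset.card_le_card fun p hp => ?_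
        simp only [Finset.mem_filter] at hp
        simp [hP, hp.2.2]
    _ ≤ _ := by
        rw [Finset.card_product, Finset.card_univ]
        refine Nat.mul_le_mul le_rfl ((Multiset.toFinset_card_le _).trans
          ((Polynomial.card_roots' _).trans_eq ?_))
        exact FiniteField.X_pow_card_sub_X_natDegree_eq L hq

end NormGraph

/-! ### Expansions, and the lower bound from triangles -/

theorem mem_graphExpansion_iff {V : Type*} [Fintype V] {G : SimpleGraph V}
    {d : Finset (V ⊕ G.edgeSet)} : d ∈ graphExpansion G ↔
      ∃ e : G.edgeSet, ∀ x, x ∈ d ↔ x = Sum.inr e ∨ ∃ v ∈ (e : Sym2 V), Sum.inl v = x := by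
  classical
  simp only [graphExpansion, Finset.mem_image, Finset.mem_univ, true_and, Finset.ext_iff,
    Finset.mem_insert, Finset.mem_map, Sym2.mem_toFinset, Function.Embedding.inl_apply]
  exact exists_congr fun e => forall_congr' fun x => iff_comm

theorem HypergraphContains.exists_mem_of_completeBipartiteExpansion {s t : ℕ} {V : Type*}
    {H : Finset (Finset V)} (h : HypergraphContains (completeBipartiteExpansion s t) H) :
    ∃ g : Fin s ⊕ Fin t ↪ V, ∀ i j, ∃ e ∈ H, g (Sum.inl i) ∈ e ∧ g (Sum.inr j) ∈ e := by
  classical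
  obtain ⟨f, hf⟩ := h
  refine ⟨Function.Embedding.inl.trans f, fun i j => ?_⟩
  let e : (completeBipartiteGraph (Fin s) (Fin t)).edgeSet :=
    ⟨s(Sum.inl i, Sum.inr j), by simp [completeBipartiteGraph]⟩
  let d : Finset ((Fin s ⊕ Fin t) ⊕ (completeBipartiteGraph (Fin s) (Fin t)).edgeSet) :=
    insert (Sum.inr e) ((e : Sym2 (Fin s ⊕ Fin t)).toFinset.map Function.Embedding.inl)
  have hd : d ∈ completeBipartiteExpansion s t :=
    mem_graphExpansion_iff.2 ⟨e, fun x => by simp [d]⟩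
  refine ⟨_, hf d hd, ?_, ?_⟩ <;>
  · refine Finset.mem_map_of_mem f (Finset.mem_insert_of_mem ?_)
    exact Finset.mem_map_of_mem Function.Embedding.inl (by simp [e])

theorem card_le_turanNumber {r n : ℕ} {W : Type*} {F : Finset (Finset W)}
    {H : Finset (Finset (Fin n))} (hr : (H : Set (Finset (Fin n))).Sized r)
    (hH : ¬ HypergraphContains F H) : H.card ≤ turanNumber r n F := by
  classical
  exact Finset.le_sup (f := Finset.card) (Finset.mem_filter.2 ⟨Finset.mem_univ _, hr, hH⟩)

/-- The triangles of a graph without `K_{s,t}` form a `3`-graph without `K_{s,t}⁺`. -/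
theorem card_cliqueFinset_three_le_turanNumber {P : Type*} [Fintype P] [DecidableEq P]
    (G : SimpleGraph P) [DecidableRel G.Adj] {n s t : ℕ} (hn : Fintype.card P ≤ n)
    (hs : s ≠ 0) (ht : t ≠ 0)
    (hG : ∀ (θ : Fin s ↪ P) (ψ : Fin t ↪ P), ¬ ∀ i j, G.Adj (θ i) (ψ j)) :
    (G.cliqueFinset 3).card ≤ turanNumber 3 n (completeBipartiteExpansion s t) := by
  classical
  obtain ⟨ι⟩ : Nonempty (P ↪ Fin n) :=
    Function.Embedding.nonempty_of_card_le (by simpa using hn)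
  rw [← Finset.card_map (Finset.mapEmbedding ι).toEmbedding]
  refine card_le_turanNumber ?_ fun hc => ?_
  · intro e he
    obtain ⟨e', he', rfl⟩ := Finset.mem_map.1 (Finset.mem_coe.1 he)
    simpa using (SimpleGraph.mem_cliqueFinset_iff.1 he').card_eq
  · obtain ⟨g, hg⟩ := hc.exists_mem_of_completeBipartiteExpansion
    have hadj : ∀ i j, ∃ x y, G.Adj x y ∧ ι x = g (Sum.inl i) ∧ ι y = g (Sum.inr j) := by
      intro i j
      obtain ⟨e, he, hi, hj⟩ := hg i j
      obtain ⟨e', he', rfl⟩ := Finset.mem_map.1 he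
      obtain ⟨x, hx, hxi⟩ := Finset.mem_map.1 hi
      obtain ⟨y, hy, hyj⟩ := Finset.mem_map.1 hj
      refine ⟨x, y, (SimpleGraph.mem_cliqueFinset_iff.1 he').isClique hx hy ?_, hxi, hyj⟩
      rintro rfl
      simpa using g.injective (hxi.symm.trans hyj)
    have hx : ∀ i, ∃ x, ι x = g (Sum.inl i) := fun i =>
      let ⟨x, _, _, hx, _⟩ := hadj i ⟨0, Nat.pos_of_ne_zero ht⟩
      ⟨x, hx⟩
    have hy : ∀ j, ∃ y, ι y = g (Sum.inr j) := fun j =>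
      let ⟨_, y, _, _, hy⟩ := hadj ⟨0, Nat.pos_of_ne_zero hs⟩ j
      ⟨y, hy⟩
    choose x hx using hx
    choose y hy using hy
    refine hG ⟨x, fun i i' h => ?_⟩ ⟨y, fun j j' h => ?_⟩ fun i j => ?_
    · have := (hx i).symm.trans ((congrArg ι h).trans (hx i'))
      simpa using g.injective this
    · have := (hy j).symm.trans ((congrArg ι h).trans (hy j'))
      simpa using g.injective this
    · obtain ⟨x', y', h, h1, h2⟩ := hadj i j
      rw [← hx] at h1
      rw [← hy] at h2
      obtain rfl := ι.injective h1
      obtain rfl := ι.injective h2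
      exact h

theorem choose_two_pow_le_turanNumber {m k n t : ℕ} (hm : m ≠ 0) (hk : k ≠ 0) (ht : k ! < t)
    (hn : (2 ^ m) ^ (k + 1) ≤ n) :
    ((2 ^ m) ^ k).choose 3 ≤ turanNumber 3 n (completeBipartiteExpansion (k + 1) t) := by
  classical
  have : Fact (Nat.Prime 2) := ⟨Nat.prime_two⟩
  let L := GaloisField 2 (m * k)
  have : Fintype L := Fintype.ofFinite L
  have hL : Fintype.card L = (2 ^ m) ^ k := by
    rw [← Nat.card_eq_fintype_card, GaloisField.card 2 _ (Nat.mul_ne_zero hm hk), pow_mul]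
  rw [← hL]
  refine (choose_three_le_card_cliqueFinset hm rfl hL).trans ?_
  refine card_cliqueFinset_three_le_turanNumber (projectiveNormGraph L (2 ^ m) k) ?_
    k.succ_ne_zero (Nat.ne_of_gt (Nat.zero_lt_of_lt ht)) fun θ ψ h => ?_
  · refine (card_normGraphVertex_le (Nat.one_lt_two_pow hm)).trans ?_
    rwa [hL, ← pow_succ]
  · exact absurd (le_factorial_of_forall_projectiveNormGraph_adj rfl (Nat.pos_of_ne_zero hk)
      θ ψ h) (not_le.2 ht)

/-- The lower bound in terms of `(s + 1)`-st powers, with `s + 1` the smaller part. -/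
theorem pow_le_turanNumber_pow {k n t : ℕ} (hk : 2 ≤ k) (ht : k ! < t) (hn : 2 ^ (k + 1) ≤ n) :
    n ^ (3 * k) ≤
      (48 * 2 ^ (3 * k) * turanNumber 3 n (completeBipartiteExpansion (k + 1) t)) ^ (k + 1) := by
  set b := 2 ^ (k + 1) with hb
  have hb1 : 1 < b := Nat.one_lt_two_pow k.succ_ne_zero
  -- The largest `q = 2 ^ m` with `q ^ (k + 1) ≤ n`; rounding loses a factor below `2 ^ (k + 1)` in
  -- `n`.
  set m := Nat.log b n with hm
  have hm0 : m ≠ 0 := (Nat.log_pos hb1 hn).ne'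
  have hle : b ^ m ≤ n := Nat.pow_log_le_self b (by omega)
  have hlt : n < b ^ (m + 1) := Nat.lt_pow_succ_log_self hb1 n
  set Q := (2 ^ m) ^ k with hQ
  have hQ4 : 4 ≤ Q := by
    calc 4 = 2 ^ 2 := rfl
      _ ≤ 2 ^ (m * k) := Nat.pow_le_pow_right two_pos
          (hk.trans (Nat.le_mul_of_pos_left k (Nat.pos_of_ne_zero hm0)))
      _ = Q := pow_mul _ _ _
  have hT := choose_two_pow_le_turanNumber hm0 (by omega : k ≠ 0) ht (n := n) (by
    rw [← pow_mul, mul_comm, pow_mul]; exact hle)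
  -- Here `48 = 2 ^ 3 * 3 !`, using `Q ≤ 2 * (Q - 2)` for `Q ≥ 4`.
  have hch : Q ^ 3 ≤ 48 * Q.choose 3 := by
    have h1 := Nat.pow_sub_le_descFactorial Q 3
    rw [Nat.descFactorial_eq_factorial_mul_choose] at h1
    have h2 : Q ≤ 2 * (Q + 1 - 3) := by omega
    calc Q ^ 3 ≤ (2 * (Q + 1 - 3)) ^ 3 := Nat.pow_le_pow_left h2 3
      _ = 8 * (Q + 1 - 3) ^ 3 := by ring
      _ ≤ 8 * (3 ! * Q.choose 3) := Nat.mul_le_mul_left _ h1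
      _ = 48 * Q.choose 3 := by simp [Nat.factorial]; ring
  calc n ^ (3 * k) ≤ (b ^ (m + 1)) ^ (3 * k) := Nat.pow_le_pow_left hlt.le _
    _ = (2 ^ (3 * k) * Q ^ 3) ^ (k + 1) := by
        rw [hb, hQ]
        simp only [← pow_mul, ← pow_add]
        congr 1; ring
    _ ≤ _ := by
        refine Nat.pow_le_pow_left ?_ _
        calc 2 ^ (3 * k) * Q ^ 3 ≤ 2 ^ (3 * k) * (48 * Q.choose 3) := Nat.mul_le_mul_left _ hch
          _ ≤ 2 ^ (3 * k) * (48 * turanNumber 3 n (completeBipartiteExpansion (k + 1) t)) := by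
              gcongr
          _ = _ := by ring

/-! ### Counting triangles in graphs without `K_{s,t}` -/

section Counting

/-- Sequences of length `s` in `Y` with a repeated entry. -/
theorem card_piFinset_filter_not_injective_le {V : Type*} [DecidableEq V] (Y : Finset V) (s : ℕ) :
    ((Fintype.piFinset fun _ : Fin s => Y).filter fun f => ¬ Function.Injective f).card ≤
      s ^ 2 * Y.card ^ (s - 1) := by
  have hsub : ((Fintype.piFinset fun _ : Fin s => Y).filter fun f => ¬ Function.Injective f) ⊆
      (Finset.univ : Finset (Fin s × Fin s)).biUnion fun p =>
        (Fintype.piFinset fun _ : Fin s => Y).filter fun f => p.1 ≠ p.2 ∧ f p.1 = f p.2 := by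
    intro f hf
    obtain ⟨hfY, hf⟩ := Finset.mem_filter.1 hf
    simp only [Function.Injective] at hf
    push Not at hf
    obtain ⟨i, j, hij, hne⟩ := hf
    exact Finset.mem_biUnion.2 ⟨(i, j), Finset.mem_univ _, Finset.mem_filter.2 ⟨hfY, hne, hij⟩⟩
  refine (Finset.card_le_card hsub).trans ((Finset.card_biUnion_le_card_mul _ _
    (Y.card ^ (s - 1)) fun p _ => ?_).trans_eq (by simp [sq]))
  by_cases hp : p.1 = p.2
  · simp [hp]
  have hcard : (Fintype.piFinset fun _ : {l : Fin s // l ≠ p.1} => Y).card = Y.card ^ (s - 1) := by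
    rw [Fintype.card_piFinset, Finset.prod_const, Finset.card_univ]
    simp
  rw [← hcard]
  refine Finset.card_le_card_of_injOn (fun f l => f l.1) (fun f hf => ?_) fun f hf g hg h => ?_
  · have := (Finset.mem_filter.1 (Finset.mem_coe.1 hf)).1
    rw [Fintype.mem_piFinset] at this
    exact Finset.mem_coe.2 (Fintype.mem_piFinset.2 fun l => this l.1)
  · have hf' := (Finset.mem_filter.1 (Finset.mem_coe.1 hf)).2.2
    have hg' := (Finset.mem_filter.1 (Finset.mem_coe.1 hg)).2.2
    have hne : ∀ l, l ≠ p.1 → f l = g l := fun l hl => congrFun h ⟨l, hl⟩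
    funext l
    by_cases hl : l = p.1
    · rw [hl, hf', hg', hne _ (Ne.symm hp)]
    · exact hne l hl

/-- **Kővári–Sós–Turán**, as a bound on a power sum of degrees. -/
theorem sum_card_filter_pow_le {V : Type*} [DecidableEq V] (X Y : Finset V) (r : V → V → Prop)
    [DecidableRel r] {s t : ℕ}
    (h : ∀ (f : Fin s ↪ V) (g : Fin t ↪ V), (∀ i, f i ∈ Y) → (∀ j, g j ∈ X) →
      ¬ ∀ i j, r (g j) (f i)) :
    ∑ x ∈ X, (Y.filter (r x)).card ^ s ≤
      t * Y.card ^ s + s ^ 2 * Y.card ^ (s - 1) * X.card := by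
  set T := Fintype.piFinset fun _ : Fin s => Y with hT
  have h1 : ∀ x, (Y.filter (r x)).card ^ s = (T.filter fun f => ∀ i, r x (f i)).card := by
    intro x
    rw [← Fintype.card_piFinset_const]
    congr 1
    ext f
    simp [hT, Fintype.mem_piFinset, forall_and]
  simp only [h1]
  -- Double counting of pairs of a vertex `x` and a sequence in its neighbourhood. An injective
  -- sequence has fewer than `t` common neighbours; the other sequences are few.
  have h2 : ∑ x ∈ X, (T.filter fun f => ∀ i, r x (f i)).card =
      ∑ f ∈ T, (X.filter fun x => ∀ i, r x (f i)).card :=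
    Finset.sum_card_bipartiteAbove_eq_sum_card_bipartiteBelow
      (fun (x : V) (f : Fin s → V) => ∀ i, r x (f i))
  rw [h2, ← Finset.sum_filter_add_sum_filter_not T (fun f => Function.Injective f)]
  refine Nat.add_le_add ?_ ?_
  · refine (Finset.sum_le_card_nsmul _ _ t fun f hf => ?_).trans ?_
    · obtain ⟨hfT, hf⟩ := Finset.mem_filter.1 hf
      by_contra hlt
      obtain ⟨g, hg⟩ : ∃ g : Fin t ↪ V, ∀ j, g j ∈ X.filter fun x => ∀ i, r x (f i) := by
        have : Nonempty (Fin t ↪ X.filter fun x => ∀ i, r x (f i)) :=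
          Function.Embedding.nonempty_of_card_le (by simpa using (not_le.1 hlt).le)
        obtain ⟨g⟩ := this
        exact ⟨g.trans (Function.Embedding.subtype _), fun j => (g j).2⟩
      refine h ⟨f, hf⟩ g (fun i => Fintype.mem_piFinset.1 hfT i)
        (fun j => (Finset.mem_filter.1 (hg j)).1) fun i j => (Finset.mem_filter.1 (hg j)).2 i
    · rw [smul_eq_mul, mul_comm]
      refine Nat.mul_le_mul_left _ ((Finset.card_filter_le _ _).trans_eq ?_)
      simp [hT]
  · refine (Finset.sum_le_card_nsmul _ _ X.card fun f _ => Finset.card_filter_le _ _).trans ?_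
    rw [smul_eq_mul]
    exact Nat.mul_le_mul_right _ (card_piFinset_filter_not_injective_le Y s)

/-- Hölder's inequality between two consecutive power sums. -/
theorem sum_pow_pow_succ_le {ι : Type*} (S : Finset ι) (d : ι → ℕ) {k : ℕ} (hk : k ≠ 0) :
    (∑ x ∈ S, d x ^ k) ^ (k + 1) ≤ S.card * (∑ x ∈ S, d x ^ (k + 1)) ^ k := by
  have hk' : (0 : ℝ) < k := by exact_mod_cast Nat.pos_of_ne_zero hk
  set p : ℝ := (k + 1) / k with hp
  have hp1 : 1 ≤ p := by rw [hp, le_div_iff₀ hk']; linarith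
  have h1 := Real.rpow_sum_le_const_mul_sum_rpow_of_nonneg (s := S) (f := fun x => (d x : ℝ) ^ k)
    hp1 (fun x _ => by positivity)
  have h2 : ∀ y : ℝ, 0 ≤ y → (y ^ p) ^ k = y ^ (k + 1) := by
    intro y hy
    rw [← Real.rpow_natCast, ← Real.rpow_mul hy, hp, div_mul_cancel₀ _ hk'.ne']
    exact_mod_cast Real.rpow_natCast y (k + 1)
  have h3 : ∀ x, ((d x : ℝ) ^ k) ^ p = (d x : ℝ) ^ (k + 1) := by
    intro x
    rw [← Real.rpow_natCast, ← Real.rpow_mul (by positivity), hp, mul_div_cancel₀ _ hk'.ne']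
    exact_mod_cast Real.rpow_natCast (d x : ℝ) (k + 1)
  have h4 : ((S.card : ℝ) ^ (p - 1)) ^ k = S.card := by
    rw [← Real.rpow_natCast, ← Real.rpow_mul (by positivity), hp]
    have : ((k + 1 : ℝ) / k - 1) * k = 1 := by field_simp; ring
    rw [this, Real.rpow_one]
  have h5 := pow_le_pow_left₀ (by positivity) h1 k
  rw [h2 _ (by positivity), mul_pow, h4] at h5
  simp only [h3] at h5
  exact_mod_cast h5

/-- The number of triangles of a graph without `K_{k+1,t}`, counted as ordered triples. -/
theorem triangle_count_pow_le {V : Type*} [Fintype V] [DecidableEq V] (G : SimpleGraph V)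
    [DecidableRel G.Adj] {k t : ℕ} (hk : k ≠ 0)
    (h : ∀ (f : Fin (k + 1) ↪ V) (g : Fin t ↪ V), ¬ ∀ i j, G.Adj (f i) (g j)) :
    (∑ v, ∑ w ∈ G.neighborFinset v, ((G.neighborFinset v).filter (G.Adj w)).card) ^ (k + 1) ≤
      (t + (k + 1) ^ 2) ^ 3 * Fintype.card V ^ (3 * k) := by
  set n := Fintype.card V with hn
  set C := t + (k + 1) ^ 2 with hC
  let d : V → ℕ := fun v => (G.neighborFinset v).card
  let c : V → V → ℕ := fun v w => ((G.neighborFinset v).filter (G.Adj w)).card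
  set T := ∑ v, ∑ w ∈ G.neighborFinset v, c v w with hT
  set E := ∑ v, d v with hE
  set M := ∑ v, d v ^ k with hM
  have hdeg : ∑ v, d v ^ (k + 1) ≤ C * n ^ (k + 1) := by
    have h1 := sum_card_filter_pow_le (Finset.univ : Finset V) Finset.univ G.Adj
      (s := k + 1) (t := t) (fun f g _ _ hfg => h f g fun i j => (hfg i j).symm)
    simp only [Finset.card_univ] at h1
    calc ∑ v, d v ^ (k + 1) = ∑ v, (Finset.univ.filter (G.Adj v)).card ^ (k + 1) := by
          refine Finset.sum_congr rfl fun v _ => ?_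
          simp only [d]
          congr 2
          ext w; simp
      _ ≤ _ := h1
      _ = C * n ^ (k + 1) := by rw [hC, hn, Nat.add_sub_cancel, pow_succ]; ring
  -- A `K_{k,t}` inside the neighbourhood of `v` becomes a `K_{k+1,t}` when `v` joins the side of
  -- size `k`.
  have hcodeg : ∀ v, ∑ w ∈ G.neighborFinset v, c v w ^ k ≤ C * d v ^ k := by
    intro v
    have h1 := sum_card_filter_pow_le (G.neighborFinset v) (G.neighborFinset v) G.Adj
      (s := k) (t := t) (fun f g hf hg hfg => by
        refine h ⟨Fin.cons v f, Fin.cons_injective_iff.2 ⟨?_, f.injective⟩⟩ g fun i j => ?_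
        · rintro ⟨i, hi⟩
          have := hf i
          rw [hi] at this
          simp at this
        · refine Fin.cases ?_ (fun i => ?_) i
          · simpa using hg j
          · simpa using (hfg i j).symm)
    refine h1.trans ?_
    have h2 : (G.neighborFinset v).card ^ (k - 1) * (G.neighborFinset v).card = d v ^ k := by
      rw [← pow_succ, Nat.sub_add_cancel (Nat.one_le_iff_ne_zero.2 hk)]
    rw [mul_assoc, h2, ← add_mul, hC]
    exact Nat.mul_le_mul_right _ (Nat.add_le_add_left (Nat.pow_le_pow_left (Nat.le_succ k) 2) t)
  have hEpow : E ^ (k + 1) ≤ C * n ^ (2 * k + 1) := by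
    have h1 := pow_sum_le_card_mul_sum_pow (s := (Finset.univ : Finset V)) (f := d)
      (fun _ _ => Nat.zero_le _) k
    refine h1.trans ((Nat.mul_le_mul_left _ hdeg).trans_eq ?_)
    rw [Finset.card_univ, Nat.cast_id, ← hn]
    ring
  have hMpow : M ^ (k + 1) ≤ n * (C * n ^ (k + 1)) ^ k := by
    refine (sum_pow_pow_succ_le Finset.univ d hk).trans ?_
    rw [Finset.card_univ]
    exact Nat.mul_le_mul_left _ (Nat.pow_le_pow_left hdeg k)
  -- Power mean over the `E` ordered adjacent pairs.
  have hTpow : T ^ k ≤ E ^ (k - 1) * (C * M) := by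
    have h1 := pow_sum_le_card_mul_sum_pow
      (s := (Finset.univ : Finset V).sigma fun v => G.neighborFinset v)
      (f := fun p => c p.1 p.2) (fun _ _ => Nat.zero_le _) (k - 1)
    rw [Nat.sub_add_cancel (Nat.one_le_iff_ne_zero.2 hk), Finset.sum_sigma, Finset.sum_sigma,
      Finset.card_sigma, Nat.cast_id] at h1
    refine h1.trans (Nat.mul_le_mul_left _ ?_)
    rw [hM, Finset.mul_sum]
    exact Finset.sum_le_sum fun v _ => hcodeg v
  refine le_of_pow_le_pow_left₀ hk (Nat.zero_le _) ?_
  calc (T ^ (k + 1)) ^ k = (T ^ k) ^ (k + 1) := pow_right_comm _ _ _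
    _ ≤ (E ^ (k - 1) * (C * M)) ^ (k + 1) := Nat.pow_le_pow_left hTpow _
    _ = (E ^ (k + 1)) ^ (k - 1) * (C ^ (k + 1) * M ^ (k + 1)) := by
        rw [mul_pow, mul_pow, pow_right_comm]
    _ ≤ (C * n ^ (2 * k + 1)) ^ (k - 1) * (C ^ (k + 1) * (n * (C * n ^ (k + 1)) ^ k)) := by
        gcongr
    _ = (C ^ 3 * n ^ (3 * k)) ^ k := by
        obtain ⟨l, rfl⟩ := Nat.exists_eq_succ_of_ne_zero hk
        simp only [Nat.succ_eq_add_one, Nat.add_sub_cancel]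
        ring_nf

theorem card_cliqueFinset_three_le_sum {V : Type*} [Fintype V] [DecidableEq V] (G : SimpleGraph V)
    [DecidableRel G.Adj] : (G.cliqueFinset 3).card ≤
      ∑ v, ∑ w ∈ G.neighborFinset v, ((G.neighborFinset v).filter (G.Adj w)).card := by
  let S : Finset (Σ _ : V, Σ _ : V, V) := (Finset.univ : Finset V).sigma fun v =>
    (G.neighborFinset v).sigma fun w => (G.neighborFinset v).filter (G.Adj w)
  have hS : S.card = ∑ v, ∑ w ∈ G.neighborFinset v,
      ((G.neighborFinset v).filter (G.Adj w)).card := by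
    simp only [S, Finset.card_sigma]
  rw [← hS]
  refine Finset.card_le_card_of_surjOn (fun p => {p.1, p.2.1, p.2.2}) fun e he => ?_
  obtain ⟨a, b, c, hab, hac, hbc, rfl⟩ :=
    SimpleGraph.is3Clique_iff.1 (SimpleGraph.mem_cliqueFinset_iff.1 he)
  exact ⟨⟨a, b, c⟩, by simp [S, hab, hac, hbc], rfl⟩

end Counting

/-! ### Reduction of the upper bound to triangle counting -/

section Cleaning

/-- Deleting edges: one can pass to a subfamily in which every `p ∈ P` that is still covered is
covered at least `D` times, at the cost of `D` edges for every `p`. -/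
theorem exists_subset_forall_le_card_filter {α β : Type*} [DecidableEq α] (r : β → α → Prop)
    [∀ p, DecidablePred (r p)] (P : Finset β) (D : ℕ) (H : Finset α) :
    ∃ H' ⊆ H, (∀ p ∈ P, (∃ e ∈ H', r p e) → D ≤ (H'.filter (r p)).card) ∧
      H.card ≤ H'.card + D * (P.filter fun p => ∃ e ∈ H, r p e).card := by
  induction H using Finset.strongInduction with
  | H H ih =>
    by_cases hgood : ∀ p ∈ P, (∃ e ∈ H, r p e) → D ≤ (H.filter (r p)).card
    · exact ⟨H, subset_rfl, hgood, Nat.le_add_right _ _⟩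
    push Not at hgood
    obtain ⟨p, hp, ⟨e, he, hpe⟩, hlt⟩ := hgood
    have hss : H.filter (fun e => ¬ r p e) ⊂ H :=
      Finset.filter_ssubset.2 ⟨e, he, by simpa using hpe⟩
    obtain ⟨H', hH', hdeg, hcard⟩ := ih _ hss
    refine ⟨H', hH'.trans hss.subset, hdeg, ?_⟩
    -- Fewer than `D` edges are deleted, and `p` is no longer covered, which pays for them.
    have hlt2 : (P.filter fun p' => ∃ e ∈ H.filter (fun e => ¬ r p e), r p' e).card <
        (P.filter fun p' => ∃ e ∈ H, r p' e).card := by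
      refine Finset.card_lt_card (Finset.ssubset_iff_of_subset ?_ |>.2 ⟨p, ?_, ?_⟩)
      · refine Finset.monotone_filter_right _ fun p' _ => ?_
        rintro ⟨e, he, h⟩
        exact ⟨e, (Finset.mem_filter.1 he).1, h⟩
      · exact Finset.mem_filter.2 ⟨hp, e, he, hpe⟩
      · intro h
        obtain ⟨-, e, he, h⟩ := Finset.mem_filter.1 h
        exact (Finset.mem_filter.1 he).2 h
    have hsplit := Finset.card_filter_add_card_filter_not (s := H) (r p)
    have := Nat.mul_le_mul_left D hlt2
    rw [Nat.mul_succ] at this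
    omega

/-- If all pairs of a `K_{s,t}` are covered by many edges of a `3`-graph, then the `3`-graph
contains the expansion `K_{s,t}⁺`. -/
theorem hypergraphContains_completeBipartiteExpansion {V : Type*} [DecidableEq V] {s t : ℕ}
    {H : Finset (Finset V)} (hH : (H : Set (Finset V)).Sized 3) (g : Fin s ⊕ Fin t ↪ V)
    (hg : ∀ i j, s + t + s * t ≤
      (H.filter fun e => {g (Sum.inl i), g (Sum.inr j)} ⊆ e).card) :
    HypergraphContains (completeBipartiteExpansion s t) H := by
  classical
  let U : Finset V := Finset.univ.map g
  have hU : U.card = s + t := by simp [U]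
  -- Candidates for the expansion vertex of a pair. The `biUnion` only provides a finite ambient
  -- set, as `V` may be infinite.
  let N : Fin s × Fin t → Finset V := fun p =>
    ((H.filter fun e => {g (Sum.inl p.1), g (Sum.inr p.2)} ⊆ e).biUnion id).filter fun v =>
      v ∉ U ∧ insert v {g (Sum.inl p.1), g (Sum.inr p.2)} ∈ H
  have hN : ∀ p, s * t ≤ (N p).card := by
    rintro ⟨i, j⟩
    have hsub : (H.filter fun e => {g (Sum.inl i), g (Sum.inr j)} ⊆ e) ⊆
        (N (i, j) ∪ U).image fun v => insert v {g (Sum.inl i), g (Sum.inr j)} := by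
      intro e he
      obtain ⟨heH, hpe⟩ := Finset.mem_filter.1 he
      have hne : g (Sum.inl i) ≠ g (Sum.inr j) := fun h => by simpa using g.injective h
      have h1 : (e \ {g (Sum.inl i), g (Sum.inr j)}).card = 1 := by
        rw [Finset.card_sdiff_of_subset hpe, hH heH, Finset.card_pair hne]
      obtain ⟨v, hv⟩ := Finset.card_eq_one.1 h1
      have hev : insert v {g (Sum.inl i), g (Sum.inr j)} = e := by
        rw [Finset.insert_eq, ← hv, Finset.sdiff_union_of_subset hpe]
      refine Finset.mem_image.2 ⟨v, ?_, hev⟩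
      by_cases hvU : v ∈ U
      · exact Finset.mem_union_right _ hvU
      · refine Finset.mem_union_left _ (Finset.mem_filter.2 ⟨Finset.mem_biUnion.2 ⟨e, he, ?_⟩,
          hvU, hev ▸ heH⟩)
        rw [← hev]; exact Finset.mem_insert_self _ _
    have h1 := (hg i j).trans ((Finset.card_le_card hsub).trans
      (Finset.card_image_le.trans (Finset.card_union_le _ _)))
    omega
  -- Hall's condition is immediate: discarding the `s + t` vertices of `U` leaves `s * t` candidates
  -- for each of the `s * t` pairs.
  obtain ⟨c, hc, hcN⟩ := (Finset.all_card_le_biUnion_card_iff_exists_injective N).1 fun S => by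
    rcases S.eq_empty_or_nonempty with rfl | ⟨p, hp⟩
    · simp
    · calc S.card ≤ s * t := by simpa using Finset.card_le_univ S
        _ ≤ (N p).card := hN p
        _ ≤ _ := Finset.card_le_card (Finset.subset_biUnion_of_mem N hp)
  have hE : ∀ e : (completeBipartiteGraph (Fin s) (Fin t)).edgeSet, ∃ p : Fin s × Fin t,
      (e : Sym2 (Fin s ⊕ Fin t)) = s(Sum.inl p.1, Sum.inr p.2) := by
    rintro ⟨e, he⟩
    induction e using Sym2.ind with
    | _ x y =>
      rcases x with i | j <;> rcases y with i' | j' <;>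
        simp [completeBipartiteGraph] at he ⊢
  choose π hπ using hE
  have hπinj : Function.Injective π := fun e e' h =>
    Subtype.ext ((hπ e).trans ((congrArg (fun p : Fin s × Fin t =>
      s((Sum.inl p.1 : Fin s ⊕ Fin t), Sum.inr p.2)) h).trans (hπ e').symm))
  have hcU : ∀ p, c p ∉ U := fun p => (Finset.mem_filter.1 (hcN p)).2.1
  let f : (Fin s ⊕ Fin t) ⊕ (completeBipartiteGraph (Fin s) (Fin t)).edgeSet → V :=
    Sum.elim g fun e => c (π e)
  have hf : Function.Injective f := by
    refine g.injective.sumElim (hc.comp hπinj) fun v e h => hcU (π e) ?_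
    rw [← h]
    exact Finset.mem_map_of_mem g (Finset.mem_univ v)
  refine ⟨⟨f, hf⟩, fun d hd => ?_⟩
  obtain ⟨e, he⟩ := mem_graphExpansion_iff.1 hd
  convert (Finset.mem_filter.1 (hcN (π e))).2.2
  ext v
  simp only [Finset.mem_map, he, hπ e, Sym2.mem_iff, Finset.mem_insert, Finset.mem_singleton]
  constructor
  · rintro ⟨x, rfl | ⟨w, rfl | rfl, rfl⟩, rfl⟩ <;> simp [f]
  · rintro (rfl | rfl | rfl)
    · exact ⟨Sum.inr e, Or.inl rfl, rfl⟩
    · exact ⟨Sum.inl (Sum.inl (π e).1), Or.inr ⟨_, Or.inl rfl, rfl⟩, rfl⟩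
    · exact ⟨Sum.inl (Sum.inr (π e).2), Or.inr ⟨_, Or.inr rfl, rfl⟩, rfl⟩

/-- A `K_{k+1,t}⁺`-free `3`-graph has, up to a quadratic number of edges, at most as many edges as
there are triangles in a `K_{k+1,t}`-free graph. -/
theorem exists_turanNumber_le_add {k t n : ℕ} (hk : k ≠ 0) : ∃ T : ℕ,
    turanNumber 3 n (completeBipartiteExpansion (k + 1) t) ≤
      T + (k + 1 + t + (k + 1) * t) * n ^ 2 ∧
    T ^ (k + 1) ≤ (t + (k + 1) ^ 2) ^ 3 * n ^ (3 * k) := by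
  classical
  set D := k + 1 + t + (k + 1) * t with hD
  rcases Finset.eq_empty_or_nonempty {H : Finset (Finset (Fin n)) |
      (H : Set (Finset (Fin n))).Sized 3 ∧
        ¬ HypergraphContains (completeBipartiteExpansion (k + 1) t) H} with hempty | hne
  · exact ⟨0, by simp [turanNumber, hempty], by simp⟩
  obtain ⟨H, hH, hHcard⟩ := Finset.exists_mem_eq_sup _ hne Finset.card
  obtain ⟨hH3, hHfree⟩ := (Finset.mem_filter.1 hH).2
  obtain ⟨H', hH', hdeg, hcard⟩ := exists_subset_forall_le_card_filter
    (fun (p : Fin n × Fin n) (e : Finset (Fin n)) => {p.1, p.2} ⊆ e) Finset.univ D H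
  let G : SimpleGraph (Fin n) := SimpleGraph.fromRel fun u v => ∃ e ∈ H', {u, v} ⊆ e
  have hG : ∀ u v, G.Adj u v ↔ u ≠ v ∧ ∃ e ∈ H', {u, v} ⊆ e := by
    intro u v
    simp only [G, SimpleGraph.fromRel_adj, Finset.pair_comm v u, or_self]
  have hfree : ∀ (f : Fin (k + 1) ↪ Fin n) (g : Fin t ↪ Fin n), ¬ ∀ i j, G.Adj (f i) (g j) := by
    intro f g hfg
    apply hHfree
    have hinj : Function.Injective (Sum.elim f g) :=
      f.injective.sumElim g.injective fun i j => (hfg i j).ne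
    obtain ⟨θ, hθ⟩ := hypergraphContains_completeBipartiteExpansion
      (hH3.mono (Finset.coe_subset.2 hH')) ⟨Sum.elim f g, hinj⟩ fun i j =>
        hdeg (f i, g j) (Finset.mem_univ _) ((hG _ _).1 (hfg i j)).2
    exact ⟨θ, fun e he => hH' (hθ e he)⟩
  refine ⟨∑ v, ∑ w ∈ G.neighborFinset v, ((G.neighborFinset v).filter (G.Adj w)).card, ?_, ?_⟩
  · refine hHcard.le.trans (hcard.trans (Nat.add_le_add ?_ (Nat.mul_le_mul_left _ ?_)))
    · refine le_trans (Finset.card_le_card fun e he => ?_) (card_cliqueFinset_three_le_sum G)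
      refine SimpleGraph.mem_cliqueFinset_iff.2 ⟨fun u hu v hv huv => (hG u v).2 ⟨huv, e, he, ?_⟩,
        hH3 (hH' he)⟩
      exact Finset.insert_subset hu (Finset.singleton_subset_iff.2 hv)
    · exact (Finset.card_le_univ _).trans_eq (by simp [sq])
  · simpa using triangle_count_pow_le G hk hfree

end Cleaning

/-! ### Asymptotic form -/

theorem rpow_three_sub_three_div_pow (n : ℕ) {k : ℕ} :
    ((n : ℝ) ^ (3 - 3 / ((k + 1 : ℕ) : ℝ))) ^ (k + 1) = (n : ℝ) ^ (3 * k) := by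
  have h : (3 - 3 / ((k + 1 : ℕ) : ℝ)) * ((k + 1 : ℕ) : ℝ) = ((3 * k : ℕ) : ℝ) := by
    have : ((k + 1 : ℕ) : ℝ) ≠ 0 := by positivity
    rw [sub_mul, div_mul_cancel₀ _ this]
    push_cast; ring
  rw [← Real.rpow_natCast, ← Real.rpow_mul (Nat.cast_nonneg n), h, Real.rpow_natCast]

theorem turanNumber_completeBipartiteExpansion_isBigO {k t : ℕ} (hk : 2 ≤ k) :
    (fun n : ℕ => (turanNumber 3 n (completeBipartiteExpansion (k + 1) t) : ℝ))
      =O[atTop] fun n : ℕ => (n : ℝ) ^ (3 - 3 / ((k + 1 : ℕ) : ℝ)) := by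
  set C : ℕ := (t + (k + 1) ^ 2) ^ 3
  set D : ℕ := k + 1 + t + (k + 1) * t
  refine IsBigO.of_bound (C + D : ℝ) ?_
  filter_upwards [eventually_ge_atTop 1] with n hn
  have hn' : (1 : ℝ) ≤ n := by exact_mod_cast hn
  obtain ⟨T, h1, h2⟩ := exists_turanNumber_le_add (k := k) (t := t) (n := n) (by omega)
  set y : ℝ := (n : ℝ) ^ (3 - 3 / ((k + 1 : ℕ) : ℝ)) with hy
  have hy0 : 0 ≤ y := by positivity
  have hT : (T : ℝ) ≤ C * y := by
    refine le_of_pow_le_pow_left₀ k.succ_ne_zero (by positivity) ?_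
    rw [Nat.succ_eq_add_one, mul_pow, hy, rpow_three_sub_three_div_pow]
    have h3 : (C : ℝ) ≤ (C : ℝ) ^ (k + 1) := by
      exact_mod_cast Nat.le_self_pow k.succ_ne_zero C
    calc (T : ℝ) ^ (k + 1) ≤ C * (n : ℝ) ^ (3 * k) := by exact_mod_cast h2
      _ ≤ _ := by gcongr
  -- This is where `s ≥ 3` enters: then `3 - 3 / s ≥ 2`, so the cleaning cost is absorbed.
  have hsq : (n : ℝ) ^ 2 ≤ y := by
    rw [hy, ← Real.rpow_natCast]
    refine Real.rpow_le_rpow_of_exponent_le hn' ?_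
    have h3 : (3 : ℝ) / ((k + 1 : ℕ) : ℝ) ≤ 1 := by
      rw [div_le_one (by positivity)]
      exact_mod_cast Nat.succ_le_succ hk
    push_cast at h3 ⊢
    linarith
  rw [Real.norm_of_nonneg (Nat.cast_nonneg _), Real.norm_of_nonneg hy0, add_mul]
  calc (turanNumber 3 n (completeBipartiteExpansion (k + 1) t) : ℝ) ≤ T + D * (n : ℝ) ^ 2 := by
        exact_mod_cast h1
    _ ≤ _ := by gcongr

theorem isBigO_turanNumber_completeBipartiteExpansion {k t : ℕ} (hk : 2 ≤ k) (ht : k ! < t) :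
    (fun n : ℕ => (n : ℝ) ^ (3 - 3 / ((k + 1 : ℕ) : ℝ)))
      =O[atTop] fun n : ℕ => (turanNumber 3 n (completeBipartiteExpansion (k + 1) t) : ℝ) := by
  refine IsBigO.of_bound (48 * 2 ^ (3 * k) : ℝ) ?_
  filter_upwards [eventually_ge_atTop (2 ^ (k + 1))] with n hn
  rw [Real.norm_of_nonneg (by positivity), Real.norm_of_nonneg (Nat.cast_nonneg _)]
  refine le_of_pow_le_pow_left₀ k.succ_ne_zero (by positivity) ?_
  rw [Nat.succ_eq_add_one, rpow_three_sub_three_div_pow]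
  exact_mod_cast pow_le_turanNumber_pow hk ht hn

theorem mainTheorem1 (s t : ℕ) (hs : 3 ≤ s) (hst : s ≤ t) :
    ((fun n : ℕ => (turanNumber 3 n (completeBipartiteExpansion s t) : ℝ))
      =O[atTop] fun n : ℕ => (n : ℝ) ^ (3 - 3 / (s : ℝ))) ∧
    ((s - 1)! < t →
      (fun n : ℕ => (turanNumber 3 n (completeBipartiteExpansion s t) : ℝ))
        =Θ[atTop] fun n : ℕ => (n : ℝ) ^ (3 - 3 / (s : ℝ))) := by
  obtain ⟨k, rfl⟩ : ∃ k, s = k + 1 := ⟨s - 1, by omega⟩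
  have hk : 2 ≤ k := by omega
  exact ⟨turanNumber_completeBipartiteExpansion_isBigO hk, fun ht =>
    ⟨turanNumber_completeBipartiteExpansion_isBigO hk,
      isBigO_turanNumber_completeBipartiteExpansion hk ht⟩⟩
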